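/- Let $(\Omega,\mathcal A,\mu)$ be a probability space, let $T:\Omega\to\Omega$ be an invertible (with measurable inverse), ergodic, measure preserving transformation, and let $(\mathcal F_i)_{i\in\mathbb Z}$ be a filtration of sub-$\sigma$-algebras of $\mathcal A$ with $\mathcal F_{i+1}=T^{-1}\mathcal F_i$ for all $i\in\mathbb Z$. Write $Uh=h\circ T$. Let $f:\Omega\to\mathbb R$ be measurable, and suppose that $$f=m+g-Ug\quad\mu\text{-a.e.},$$ where $g\in L^2(\mu)$ and $m\in L^2(\mu)$ is $\mathcal F_0$-measurable with $E(Um\mid\mathcal F_0)=0$ a.e. Put $S_n(f)=Uf+U^2f+\cdots+U^nf$ for $n\ge 1$. Let $\omega\mapsto\mu_\omega$ be a regular conditional probability on $\mathcal B=\sigma\{U^kf: k\ge 1\}$ given $\mathcal F_0$; that is, each $\mu_\omega$ is a probability measure on $\mathcal B$ and, for each $B\in\mathcal B$, $\omega\mapsto\mu_\omega(B)$ is an $\mathcal F_0$-measurable version of $\mu(B\mid\mathcal F_0)$. Let $$G_n(\omega;z)=\mu_\omega\{S_n(f)/\sqrt n\le z\},\qquad z\in\mathbb R.$$ Then for $\mu$-a.e.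 $\omega$ the distribution functions $G_n(\omega;\cdot)$ converge weakly, as $n\to\infty$, to the distribution function $G$ of the normal distribution with mean $0$ and variance $\|m\|_2^2$ (the point mass at $0$ if $\|m\|_2=0$); that is, $G_n(\omega;z)\to G(z)$ at every continuity point $z$ of $G$. -/

import Mathlib

open MeasureTheory ProbabilityTheory Filter Topology

/-- The partial sums `S_n(f) = f ∘ T + f ∘ T² + ⋯ + f ∘ Tⁿ`. -/
def birkhoffPartialSum {Ω : Type*} (T : Ω → Ω) (f : Ω → ℝ) (n : ℕ) (ω : Ω) : ℝ :=
  ∑ k ∈ Finset.Icc 1 n, f (T^[k] ω)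

/-- The σ-algebra `σ{X_1, X_2, …}` generated by the variables `X_k = f ∘ T^k`, `k ≥ 1`. -/
abbrev futureSigmaAlgebra {Ω : Type*} (T : Ω → Ω) (f : Ω → ℝ) : MeasurableSpace Ω :=
  ⨆ k : ℕ, ⨆ _ : 1 ≤ k, MeasurableSpace.comap (fun ω => f (T^[k] ω)) inferInstance

/-- The kernel `κ` from `(Ω, 𝓖)` to `(Ω, 𝓑)` is a regular conditional probability on `𝓑`
given `𝓖`: every `κ ω` is a probability measure on `𝓑` and, for every `B ∈ 𝓑`, the
(`𝓖`-measurable) function `ω ↦ κ ω B` is a version of `μ(B | 𝓖)`. -/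
structure IsRegularCondProb {Ω : Type*} {mΩ : MeasurableSpace Ω} (μ : Measure Ω)
    (𝓖 𝓑 : MeasurableSpace Ω) (κ : @Kernel Ω Ω 𝓖 𝓑) : Prop where
  isProbabilityMeasure : ∀ ω, IsProbabilityMeasure (κ ω)
  ae_eq_condProb : ∀ B : Set Ω, MeasurableSet[𝓑] B →
    (fun ω => (κ ω).real B) =ᵐ[μ] μ[B.indicator (fun _ => (1 : ℝ)) | 𝓖]

/-- The martingale difference space: the `𝓕₀`-measurable `m ∈ L²(μ)` with
`E(m ∘ T | 𝓕₀) = 0`. -/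
def martingaleDifferenceSpace {Ω : Type*} {mΩ : MeasurableSpace Ω} (μ : Measure Ω)
    (𝓕₀ : MeasurableSpace Ω) (T : Ω → Ω) : Set (Ω → ℝ) :=
  {m | Measurable[𝓕₀] m ∧ MemLp m 2 μ ∧ μ[m ∘ T | 𝓕₀] =ᵐ[μ] 0}

/-- The conditional distribution function `G_n(ω; z) = μ_ω{S_n(f)/√n ≤ z}`, where `μ_ω = κ ω`. -/
noncomputable def condDistribFun {Ω : Type*} (T : Ω → Ω) (f : Ω → ℝ)
    {𝓖 : MeasurableSpace Ω} (κ : @Kernel Ω Ω 𝓖 (futureSigmaAlgebra T f))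
    (n : ℕ) (ω : Ω) (z : ℝ) : ℝ :=
  (κ ω).real {ω' | birkhoffPartialSum T f n ω' / Real.sqrt n ≤ z}

/-- Weak convergence `G_n ⇒ G` of distribution functions on the line: pointwise convergence at
every continuity point of the limit `G`. -/
def DistribFunTendsto (G : ℕ → ℝ → ℝ) (G' : ℝ → ℝ) : Prop :=
  ∀ z : ℝ, ContinuousAt G' z → Tendsto (fun n => G n z) atTop (𝓝 (G' z))

/-! The coboundary telescopes, so `S_n(f)` is the martingale sum of `m ∘ T^k`, `1 ≤ k ≤ n`, plus `g
∘ T - g ∘ T^{n+1}`, which is `o(√n)` a.e. because `g ∈ L²`. What remains is a central limit theorem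
for stationary martingale differences, conditional on `𝓕 0` and valid for almost every `ω`.

With `v = ∫ m²` and `x_k = m ∘ T^{k+1} / √n`, McLeish's method compares `e^{itS}` with `∏ (1 + i t
x_k) · e^{-t²v/2}`. Once the `x_k` are stopped predictably when `∑ x_k²` passes `v + 1`, the product
has conditional expectation exactly one (`condExp_stoppedProd`). The error tends to zero pointwise,
since Birkhoff's theorem gives `∑ x_k² → v` and `max |x_k| → 0` (`tendsto_mcleishError`).

Almost sure convergence of the conditional expectations needs one integrable bound for all `n`. The
stopped product grows only linearly in `max |x_k|` (`norm_stoppedProd_le`), and `sup_k |m ∘ T^{k+1}|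
/ √(k+1)` is integrable for `m ∈ L²` (`exists_integrable_bound_iterate`). Conditional dominated
convergence then gives convergence of the conditional characteristic functions, uniformly over
bounded rational `t`. Continuity and Lévy's theorem finish the argument. -/

/-! ### The maximal and pointwise ergodic theorems. -/

/-- The running maximum `max(0, S_1 h, …, S_n h)` of the Birkhoff sums of `h`. -/
noncomputable def birkhoffMax {Ω : Type*} (T : Ω → Ω) (h : Ω → ℝ) : ℕ → Ω → ℝ
  | 0, _ => 0
  | n + 1, ω => max 0 (h ω + birkhoffMax T h n (T ω))

section BirkhoffMax

variable {Ω : Type*} {T : Ω → Ω} {h : Ω → ℝ}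

lemma birkhoffMax_nonneg (n : ℕ) (ω : Ω) : 0 ≤ birkhoffMax T h n ω := by
  cases n <;> simp [birkhoffMax]

lemma birkhoffSum_le_birkhoffMax (n : ℕ) (ω : Ω) :
    birkhoffSum T h n ω ≤ birkhoffMax T h n ω := by
  induction n generalizing ω with
  | zero => simp [birkhoffMax]
  | succ n ih =>
    rw [birkhoffSum_succ', birkhoffMax]
    exact (add_le_add_right (ih (T ω)) (h ω)).trans (le_max_right _ _)

lemma birkhoffMax_le_succ (n : ℕ) (ω : Ω) :
    birkhoffMax T h n ω ≤ birkhoffMax T h (n + 1) ω := by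
  induction n generalizing ω with
  | zero => exact birkhoffMax_nonneg _ _
  | succ n ih =>
    rw [birkhoffMax, birkhoffMax]
    exact max_le_max le_rfl (add_le_add_right (ih (T ω)) (h ω))

lemma birkhoffMax_mono (ω : Ω) : Monotone fun n => birkhoffMax T h n ω :=
  monotone_nat_of_le_succ fun n => birkhoffMax_le_succ n ω

/-- Makes the set of bounded orbits `T`-invariant, so that ergodicity leaves only measure zero or
full measure. -/
lemma bddAbove_birkhoffMax_comp_iff (ω : Ω) :
    BddAbove (Set.range fun n => birkhoffMax T h n (T ω)) ↔
      BddAbove (Set.range fun n => birkhoffMax T h n ω) := by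
  constructor
  · rintro ⟨C, hC⟩
    refine ⟨max 0 (h ω + C), ?_⟩
    rintro _ ⟨n, rfl⟩
    refine (birkhoffMax_le_succ n ω).trans ?_
    exact max_le_max le_rfl (add_le_add_right (hC ⟨n, rfl⟩) (h ω))
  · rintro ⟨C, hC⟩
    refine ⟨C - h ω, ?_⟩
    rintro _ ⟨n, rfl⟩
    have h1 : birkhoffMax T h (n + 1) ω ≤ C := hC ⟨n + 1, rfl⟩
    have h2 : h ω + birkhoffMax T h n (T ω) ≤ birkhoffMax T h (n + 1) ω := le_max_right _ _
    show birkhoffMax T h n (T ω) ≤ C - h ω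
    linarith

/-- The right side is dominated by `|h|` and equals `h` once the maximum at `T ω` is large, while
the left side has nonnegative integral by invariance and monotonicity in `n`. -/
lemma birkhoffMax_succ_sub (n : ℕ) (ω : Ω) :
    birkhoffMax T h (n + 1) ω - birkhoffMax T h n (T ω) =
      max (-birkhoffMax T h n (T ω)) (h ω) := by
  rw [birkhoffMax, max_sub_sub_right 0 _ _ |>.symm]
  congr 1 <;> ring

variable [mΩ : MeasurableSpace Ω] {μ : Measure Ω}

lemma measurable_birkhoffMax (hT : Measurable T) (hh : Measurable h) (n : ℕ) :
    Measurable (birkhoffMax T h n) := by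
  induction n with
  | zero => exact measurable_const
  | succ n ih => exact measurable_const.max (hh.add (ih.comp hT))

lemma integrable_birkhoffMax (hT : MeasurePreserving T μ μ) (hh : Integrable h μ)
    (n : ℕ) : Integrable (birkhoffMax T h n) μ := by
  induction n with
  | zero => exact integrable_zero _ _ _
  | succ n ih => exact (integrable_zero _ _ _).sup (hh.add (hT.integrable_comp_of_integrable ih))

/-- **Maximal ergodic theorem**, ergodic case: if `∫ h < 0`, the Birkhoff sums of `h` are almost
surely bounded above. -/
lemma Ergodic.ae_bddAbove_birkhoffMax (hT : Ergodic T μ) (hm : Measurable h)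
    (hh : Integrable h μ) (hneg : ∫ ω, h ω ∂μ < 0) :
    ∀ᵐ ω ∂μ, BddAbove (Set.range fun n => birkhoffMax T h n ω) := by
  have hset : MeasurableSet {ω | BddAbove (Set.range fun n => birkhoffMax T h n ω)} :=
    measurableSet_bddAbove_range fun n => measurable_birkhoffMax hT.measurable hm n
  rcases hT.toPreErgodic.ae_mem_or_ae_notMem hset
    (Set.ext fun ω => bddAbove_birkhoffMax_comp_iff ω) with H | H
  · exact H
  exfalso
  have hTint : ∀ n, Integrable (fun ω => birkhoffMax T h n (T ω)) μ := fun n =>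
    hT.toMeasurePreserving.integrable_comp_of_integrable
      (integrable_birkhoffMax hT.toMeasurePreserving hh n)
  have hlim : Tendsto (fun n => ∫ ω, max (-birkhoffMax T h n (T ω)) (h ω) ∂μ) atTop
      (𝓝 (∫ ω, h ω ∂μ)) := by
    refine tendsto_integral_of_dominated_convergence (fun ω => |h ω|) (fun n => ?_) hh.abs
      (fun n => ?_) ?_
    · exact ((hTint n).neg.sup hh).aestronglyMeasurable
    · filter_upwards with ω
      have := birkhoffMax_nonneg (T := T) (h := h) n (T ω)
      rw [Real.norm_eq_abs, abs_le]
      exact ⟨(neg_abs_le _).trans (le_max_right _ _),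
        max_le (by linarith [abs_nonneg (h ω)]) (le_abs_self _)⟩
    · filter_upwards [H] with ω hω
      have hω' : ¬ BddAbove (Set.range fun n => birkhoffMax T h n (T ω)) := fun hb =>
        hω ((bddAbove_birkhoffMax_comp_iff ω).1 hb)
      have htop : Tendsto (fun n => birkhoffMax T h n (T ω)) atTop atTop :=
        tendsto_atTop_atTop_of_monotone' (birkhoffMax_mono _) hω'
      refine tendsto_const_nhds.congr' ?_
      filter_upwards [htop.eventually_ge_atTop (-h ω)] with n hn
      rw [max_eq_right (by linarith)]
  -- If the maxima were a.s. unbounded, `∫ h` would be a limit of nonnegative integrals.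
  refine absurd (ge_of_tendsto' hlim fun n => ?_) (not_le.2 hneg)
  have h1 : ∫ ω, birkhoffMax T h n (T ω) ∂μ = ∫ ω, birkhoffMax T h n ω ∂μ := by
    conv_rhs => rw [← hT.map_eq]
    exact (integral_map hT.measurable.aemeasurable
      (measurable_birkhoffMax hT.measurable hm n).aestronglyMeasurable).symm
  simp_rw [← birkhoffMax_succ_sub]
  rw [integral_sub (integrable_birkhoffMax hT.toMeasurePreserving hh _) (hTint n), h1, sub_nonneg]
  exact integral_mono (integrable_birkhoffMax hT.toMeasurePreserving hh _)
    (integrable_birkhoffMax hT.toMeasurePreserving hh _) fun ω => birkhoffMax_le_succ n ω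

lemma Ergodic.ae_eventually_birkhoffSum_lt [IsProbabilityMeasure μ] (hT : Ergodic T μ)
    (hm : Measurable h) (hh : Integrable h μ) {c : ℝ} (hc : ∫ ω, h ω ∂μ < c) :
    ∀ᵐ ω ∂μ, ∀ᶠ n : ℕ in atTop, birkhoffSum T h n ω / n < c := by
  obtain ⟨d, hd, hdc⟩ := exists_between hc
  have hneg : ∫ ω, (h ω - d) ∂μ < 0 := by
    rw [integral_sub hh (integrable_const d)]
    simpa using hd
  filter_upwards [hT.ae_bddAbove_birkhoffMax (hm.sub_const d) (hh.sub (integrable_const d)) hneg]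
    with ω hω
  obtain ⟨C, hC⟩ := hω
  have hlim : Tendsto (fun n : ℕ => C / (n : ℝ) + d) atTop (𝓝 (0 + d)) :=
    (tendsto_const_div_atTop_nhds_zero_nat C).add_const d
  rw [zero_add] at hlim
  filter_upwards [hlim.eventually_lt_const hdc, eventually_gt_atTop 0] with n hn hn0
  have hn0' : (0 : ℝ) < n := by exact_mod_cast hn0
  have h1 := (birkhoffSum_le_birkhoffMax (T := T) (h := fun ω => h ω - d) n ω).trans (hC ⟨n, rfl⟩)
  have h2 : birkhoffSum T (fun ω => h ω - d) n ω = birkhoffSum T h n ω - n * d := by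
    simp [birkhoffSum, Finset.sum_sub_distrib]
  rw [h2] at h1
  refine lt_of_le_of_lt ?_ hn
  rw [div_add' _ _ _ hn0'.ne', div_le_div_iff_of_pos_right hn0']
  linarith

/-- **Birkhoff's pointwise ergodic theorem**, ergodic case. -/
theorem Ergodic.ae_tendsto_birkhoffSum_div [IsProbabilityMeasure μ] (hT : Ergodic T μ)
    (hh : Integrable h μ) :
    ∀ᵐ ω ∂μ, Tendsto (fun n : ℕ => birkhoffSum T h n ω / n) atTop (𝓝 (∫ ω, h ω ∂μ)) := by
  wlog hm : Measurable h generalizing h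
  · have hk := hh.aestronglyMeasurable.aemeasurable
    have heq : h =ᵐ[μ] hk.mk h := hk.ae_eq_mk
    have hall : ∀ᵐ ω ∂μ, ∀ n, birkhoffSum T h n ω = birkhoffSum T (hk.mk h) n ω :=
      ae_all_iff.2 fun n => hT.quasiMeasurePreserving.birkhoffSum_ae_eq_of_ae_eq heq n
    filter_upwards [this (hh.congr heq) hk.measurable_mk, hall] with ω h1 h2
    rw [integral_congr_ae heq]
    simpa only [h2] using h1
  have key : ∀ᵐ ω ∂μ, ∀ k : ℕ,
      (∀ᶠ n : ℕ in atTop, birkhoffSum T h n ω / n < ∫ ω, h ω ∂μ + 1 / ((k : ℝ) + 1)) ∧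
      (∀ᶠ n : ℕ in atTop, ∫ ω, h ω ∂μ - 1 / ((k : ℝ) + 1) < birkhoffSum T h n ω / n) := by
    refine ae_all_iff.2 fun k => ?_
    have hk : 0 < 1 / ((k : ℝ) + 1) := by positivity
    have hneg : ∫ ω, (-h) ω ∂μ < -(∫ ω, h ω ∂μ - 1 / ((k : ℝ) + 1)) := by
      simp only [Pi.neg_apply, integral_neg]
      linarith
    filter_upwards [hT.ae_eventually_birkhoffSum_lt hm hh (lt_add_of_pos_right _ hk),
      hT.ae_eventually_birkhoffSum_lt hm.neg hh.neg hneg] with ω h1 h2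
    refine ⟨h1, h2.mono fun n hn => ?_⟩
    rw [birkhoffSum_neg, neg_div] at hn
    linarith
  filter_upwards [key] with ω hω
  rw [tendsto_order]
  constructor
  · intro a ha
    obtain ⟨k, hk⟩ := exists_nat_one_div_lt (sub_pos.2 ha)
    filter_upwards [(hω k).2] with n hn
    linarith
  · intro a ha
    obtain ⟨k, hk⟩ := exists_nat_one_div_lt (sub_pos.2 ha)
    filter_upwards [(hω k).1] with n hn
    linarith

end BirkhoffMax

/-! ### Growth of the iterates of a square integrable function. -/

lemma sum_max_div_sqrt_sub_one_le {a : ℝ} (ha : 0 ≤ a) (N : ℕ) :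
    ∑ k ∈ Finset.range N, max (a / √((k : ℝ) + 1) - 1) 0 ≤ 2 * a ^ 2 := by
  -- Only terms with `k + 1 < a²` contribute, and there `1/√(k+1) ≤ 2(√(k+1) - √k)` telescopes; the
  -- minimum records where the sum stops growing.
  suffices H : ∑ k ∈ Finset.range N, max (a / √((k : ℝ) + 1) - 1) 0 ≤ 2 * a * min √(N : ℝ) a by
    refine H.trans ?_
    have := mul_le_mul_of_nonneg_left (min_le_right √(N : ℝ) a) (by positivity : 0 ≤ 2 * a)
    linarith
  induction N with
  | zero => simp [ha]
  | succ N ih =>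
    rw [Finset.sum_range_succ]
    have hs0 : 0 ≤ √(N : ℝ) := Real.sqrt_nonneg _
    have hs1 : 0 < √((N : ℝ) + 1) := Real.sqrt_pos.2 (by positivity)
    have hle : √(N : ℝ) ≤ √((N : ℝ) + 1) := Real.sqrt_le_sqrt (by linarith)
    push_cast
    rcases le_or_gt a √((N : ℝ) + 1) with h | h
    · have h1 : a / √((N : ℝ) + 1) ≤ 1 := (div_le_one hs1).2 h
      rw [max_eq_right (by linarith), add_zero]
      exact ih.trans (mul_le_mul_of_nonneg_left (min_le_min_right _ hle) (by positivity))
    · have h1 : 1 ≤ a / √((N : ℝ) + 1) := (one_le_div hs1).2 h.le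
      rw [max_eq_left (by linarith), min_eq_left h.le]
      rw [min_eq_left (hle.trans h.le)] at ih
      have h2 : a / √((N : ℝ) + 1) ≤ 2 * a * (√((N : ℝ) + 1) - √(N : ℝ)) := by
        rw [div_le_iff₀ hs1]
        have e1 : √((N : ℝ) + 1) ^ 2 = (N : ℝ) + 1 := Real.sq_sqrt (by positivity)
        have e0 : √(N : ℝ) ^ 2 = (N : ℝ) := Real.sq_sqrt (by positivity)
        have e2 : 1 ≤ 2 * (√((N : ℝ) + 1) - √(N : ℝ)) * √((N : ℝ) + 1) := by
          nlinarith [sq_nonneg (√((N : ℝ) + 1) - √(N : ℝ))]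
        nlinarith
      linarith

section Iterates

variable {Ω : Type*} [mΩ : MeasurableSpace Ω] {μ : Measure Ω} {T : Ω → Ω} {h : Ω → ℝ}

/-- The iterates of a square integrable function are dominated by `√k` times an integrable
function. -/
lemma MeasureTheory.MeasurePreserving.exists_integrable_bound_iterate [IsFiniteMeasure μ]
    (hT : MeasurePreserving T μ μ) (hm : Measurable h) (hh : MemLp h 2 μ) :
    ∃ R : Ω → ℝ, Measurable R ∧ Integrable R μ ∧ (∀ ω, 0 ≤ R ω) ∧
      ∀ᵐ ω ∂μ, ∀ k : ℕ, |h (T^[k + 1] ω)| ≤ R ω * √((k : ℝ) + 1) := by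
  -- The supremum of `|h ∘ T^{k+1}| / √(k+1)` is at most one plus the sum of the excesses over one;
  -- by invariance that sum has integral at most `2 ∫ h²`.
  set F : ℕ → Ω → ENNReal := fun k ω => ENNReal.ofReal (max (|h ω| / √((k : ℝ) + 1) - 1) 0)
    with hF
  have hFm : ∀ k, Measurable (F k) := fun k =>
    (((hm.abs.div_const _).sub_const _).max measurable_const).ennreal_ofReal
  set L : Ω → ENNReal := fun ω => ∑' k, F k (T^[k + 1] ω) with hL
  have hLm : Measurable L :=
    Measurable.tsum fun k => (hFm k).comp (hT.iterate (k + 1)).measurable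
  have hsum : ∀ ω, ∑' k, F k ω ≤ ENNReal.ofReal (2 * h ω ^ 2) := by
    intro ω
    refine ENNReal.tsum_le_of_sum_range_le fun N => ?_
    rw [← ENNReal.ofReal_sum_of_nonneg fun k _ => le_max_right _ _]
    refine ENNReal.ofReal_le_ofReal ?_
    rw [← sq_abs (h ω)]
    exact sum_max_div_sqrt_sub_one_le (abs_nonneg (h ω)) N
  have hLint : ∫⁻ ω, L ω ∂μ ≠ ⊤ := by
    have h1 : ∫⁻ ω, L ω ∂μ = ∫⁻ ω, ∑' k, F k ω ∂μ := by
      rw [lintegral_tsum fun k => (hFm k).aemeasurable, hL,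
        lintegral_tsum (f := fun k ω => F k (T^[k + 1] ω))
          fun k => ((hFm k).comp (hT.iterate (k + 1)).measurable).aemeasurable]
      exact tsum_congr fun k => (hT.iterate (k + 1)).lintegral_comp (hFm k)
    rw [h1]
    refine ne_top_of_le_ne_top ?_ (lintegral_mono hsum)
    exact (hh.integrable_sq.const_mul 2).lintegral_lt_top.ne
  refine ⟨fun ω => 1 + (L ω).toReal, hLm.ennreal_toReal.const_add 1, ?_, fun ω => by positivity, ?_⟩
  · exact (integrable_const 1).add (integrable_toReal_of_lintegral_ne_top hLm.aemeasurable hLint)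
  · filter_upwards [ae_lt_top hLm hLint] with ω hω k
    have hs : 0 < √((k : ℝ) + 1) := Real.sqrt_pos.2 (by positivity)
    have h1 : F k (T^[k + 1] ω) ≤ L ω := ENNReal.le_tsum k
    have h2 := (ENNReal.ofReal_le_iff_le_toReal hω.ne).1 h1
    have h3 := (le_max_left _ _).trans h2
    rw [← div_le_iff₀ hs]
    linarith

/-- An iterate is the difference of consecutive Birkhoff sums, whose averages share a limit. -/
lemma Ergodic.ae_tendsto_iterate_div [IsProbabilityMeasure μ] (hT : Ergodic T μ)
    (hh : Integrable h μ) :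
    ∀ᵐ ω ∂μ, Tendsto (fun n : ℕ => h (T^[n] ω) / n) atTop (𝓝 0) := by
  filter_upwards [hT.ae_tendsto_birkhoffSum_div hh] with ω hω
  have h1 : Tendsto (fun n : ℕ => birkhoffSum T h (n + 1) ω / ((n + 1 : ℕ) : ℝ)) atTop
      (𝓝 (∫ ω, h ω ∂μ)) := hω.comp (tendsto_add_atTop_nat 1)
  have h2 : Tendsto (fun n : ℕ => ((n : ℝ) + 1) / n) atTop (𝓝 1) := by
    have : Tendsto (fun n : ℕ => 1 + 1 / (n : ℝ)) atTop (𝓝 (1 + 0)) :=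
      tendsto_const_nhds.add (tendsto_const_div_atTop_nhds_zero_nat 1)
    rw [add_zero] at this
    refine this.congr' ?_
    filter_upwards [eventually_gt_atTop 0] with n hn
    have : (n : ℝ) ≠ 0 := by exact_mod_cast hn.ne'
    field_simp
  have h3 := (h1.mul h2).sub hω
  rw [mul_one, sub_self] at h3
  refine h3.congr' ?_
  filter_upwards [eventually_gt_atTop 0] with n hn
  have hn1 : (n : ℝ) ≠ 0 := by exact_mod_cast hn.ne'
  have hn2 : (n : ℝ) + 1 ≠ 0 := by positivity
  rw [birkhoffSum_succ]
  push_cast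
  field_simp
  ring

lemma Ergodic.ae_tendsto_iterate_div_sqrt [IsProbabilityMeasure μ] (hT : Ergodic T μ)
    (hh : MemLp h 2 μ) :
    ∀ᵐ ω ∂μ, Tendsto (fun n : ℕ => |h (T^[n] ω)| / √(n : ℝ)) atTop (𝓝 0) := by
  filter_upwards [hT.ae_tendsto_iterate_div hh.integrable_sq] with ω hω
  have := hω.sqrt
  rw [Real.sqrt_zero] at this
  refine this.congr fun n => ?_
  rw [Real.sqrt_div (sq_nonneg _), Real.sqrt_sq_eq_abs]

end Iterates

/-! ### Dominated convergence under conditional expectation. -/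

section CondExp

variable {Ω : Type*} {m0 mΩ : MeasurableSpace Ω} {μ : Measure Ω}

/-- Dominated convergence for conditional expectations, for nonnegative functions
converging to zero. -/
lemma MeasureTheory.ae_tendsto_condExp_zero_of_dominated [IsFiniteMeasure μ] (hm : m0 ≤ mΩ)
    {H : ℕ → Ω → ℝ} {G : Ω → ℝ} (hH : ∀ n, Measurable (H n)) (hG : Integrable G μ)
    (hH0 : ∀ n ω, 0 ≤ H n ω) (hHG : ∀ n ω, H n ω ≤ G ω)
    (hlim : ∀ᵐ ω ∂μ, Tendsto (fun n => H n ω) atTop (𝓝 0)) :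
    ∀ᵐ ω ∂μ, Tendsto (fun n => (μ[H n | m0]) ω) atTop (𝓝 0) := by
  -- Tail suprema decrease in `n`, so their conditional expectations decrease a.e.; as the integrals
  -- tend to zero, so does the a.e. limit.
  set W : ℕ → Ω → ℝ := fun n ω => ⨆ k, H (n + k) ω with hW
  have hbdd : ∀ n ω, BddAbove (Set.range fun k => H (n + k) ω) := fun n ω =>
    ⟨G ω, by rintro _ ⟨k, rfl⟩; exact hHG _ _⟩
  have hHW : ∀ n ω, H n ω ≤ W n ω := fun n ω => le_ciSup (hbdd n ω) 0
  have hW0 : ∀ n ω, 0 ≤ W n ω := fun n ω => (hH0 n ω).trans (hHW n ω)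
  have hWG : ∀ n ω, W n ω ≤ G ω := fun n ω => ciSup_le fun k => hHG _ _
  have hWm : ∀ n, Measurable (W n) := fun n => Measurable.iSup fun k => hH (n + k)
  have hint : ∀ {f : Ω → ℝ}, Measurable f → (∀ ω, 0 ≤ f ω) → (∀ ω, f ω ≤ G ω) →
      Integrable f μ := fun hf h0 h1 =>
    hG.mono' hf.aestronglyMeasurable (ae_of_all _ fun ω => by
      rw [Real.norm_eq_abs, abs_of_nonneg (h0 ω)]; exact h1 ω)
  have hWint : ∀ n, Integrable (W n) μ := fun n => hint (hWm n) (hW0 n) (hWG n)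
  have hWanti : ∀ n, W (n + 1) ≤ W n := fun n ω => by
    refine ciSup_le fun k => ?_
    have := le_ciSup (hbdd n ω) (1 + k)
    rwa [← add_assoc] at this
  have hWlim : ∀ᵐ ω ∂μ, Tendsto (fun n => W n ω) atTop (𝓝 0) := by
    filter_upwards [hlim] with ω hω
    rw [Metric.tendsto_atTop] at hω ⊢
    intro ε hε
    obtain ⟨N, hN⟩ := hω (ε / 2) (by positivity)
    refine ⟨N, fun n hn => ?_⟩
    rw [Real.dist_0_eq_abs, abs_of_nonneg (hW0 n ω)]
    refine lt_of_le_of_lt (ciSup_le fun k => ?_) (half_lt_self hε)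
    have := hN (n + k) (by omega)
    rw [Real.dist_0_eq_abs] at this
    exact ((le_abs_self _).trans this.le)
  have hIlim : Tendsto (fun n => ∫ ω, (μ[W n | m0]) ω ∂μ) atTop (𝓝 (∫ _, (0 : ℝ) ∂μ)) := by
    simp_rw [integral_condExp hm]
    exact tendsto_integral_of_dominated_convergence G (fun n => (hWm n).aestronglyMeasurable) hG
      (fun n => ae_of_all _ fun ω => by
        rw [Real.norm_eq_abs, abs_of_nonneg (hW0 n ω)]; exact hWG n ω) hWlim
  have hcW : ∀ᵐ ω ∂μ, Tendsto (fun n => (μ[W n | m0]) ω) atTop (𝓝 0) := by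
    refine tendsto_of_integral_tendsto_of_antitone (F := fun _ => 0)
      (fun n => integrable_condExp) (integrable_zero _ _ _) hIlim ?_ ?_
    · have : ∀ᵐ ω ∂μ, ∀ n, (μ[W (n + 1) | m0]) ω ≤ (μ[W n | m0]) ω := ae_all_iff.2 fun n =>
        condExp_mono (hWint _) (hWint _) (ae_of_all _ (hWanti n))
      filter_upwards [this] with ω hω using antitone_nat_of_succ_le hω
    · exact ae_all_iff.2 fun n => condExp_nonneg (ae_of_all _ (hW0 n))
  have h0 : ∀ᵐ ω ∂μ, ∀ n, 0 ≤ (μ[H n | m0]) ω :=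
    ae_all_iff.2 fun n => condExp_nonneg (ae_of_all _ (hH0 n))
  have h1 : ∀ᵐ ω ∂μ, ∀ n, (μ[H n | m0]) ω ≤ (μ[W n | m0]) ω := ae_all_iff.2 fun n =>
    condExp_mono (hint (hH n) (hH0 n) (hHG n)) (hWint n) (ae_of_all _ (hHW n))
  filter_upwards [hcW, h0, h1] with ω a b c
  exact squeeze_zero b c a

end CondExp

/-! ### McLeish's comparison of exponentials with products. -/

lemma Complex.norm_one_add_I_mul_sq (x : ℝ) : ‖1 + Complex.I * x‖ ^ 2 = 1 + x ^ 2 := by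
  rw [Complex.sq_norm, Complex.normSq_apply]
  simp
  ring

lemma Complex.norm_one_add_I_mul_mul_exp_le_one (x : ℝ) :
    ‖(1 + Complex.I * x) * (Real.exp (-(x ^ 2 / 2)) : ℂ)‖ ≤ 1 := by
  refine (sq_le_one_iff₀ (norm_nonneg _)).1 ?_
  rw [norm_mul, mul_pow, Complex.norm_one_add_I_mul_sq, Complex.norm_real, Real.norm_eq_abs,
    sq_abs, ← Real.exp_nat_mul]
  have h1 : ((2 : ℕ) : ℝ) * -(x ^ 2 / 2) = -(x ^ 2) := by push_cast; ring
  rw [h1, Real.exp_neg, ← div_eq_mul_inv, div_le_one (Real.exp_pos _)]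
  linarith [Real.add_one_le_exp (x ^ 2)]

/-- Third order comparison of `e^{ix}` with `(1 + ix) e^{-x²/2}`. -/
lemma Complex.norm_exp_I_mul_sub_le (x : ℝ) :
    ‖Complex.exp (Complex.I * x) - (1 + Complex.I * x) * (Real.exp (-(x ^ 2 / 2)) : ℂ)‖
      ≤ 2 * |x| ^ 3 := by
  -- For small `x` the Taylor remainders contribute `1 + 1/2 + 1/2` times `|x|³`; for large `x` both
  -- terms have norm at most one.
  rcases le_or_gt |x| 1 with hx | hx
  · have hIx : ‖Complex.I * (x : ℂ)‖ = |x| := by simp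
    have h1 := Complex.exp_bound (x := Complex.I * x) (by rw [hIx]; exact hx)
      (n := 3) (by norm_num)
    rw [hIx] at h1
    simp only [Finset.sum_range_succ, Finset.sum_range_zero, Nat.factorial] at h1
    have hx2 : x ^ 2 ≤ 1 := by rw [← sq_abs]; exact pow_le_one₀ (abs_nonneg x) hx
    have hy : |-(x ^ 2 / 2)| ≤ 1 := by
      rw [abs_neg, abs_of_nonneg (by positivity)]; linarith
    have h2 := Real.abs_exp_sub_one_sub_id_le hy
    set r1 : ℂ := Complex.exp (Complex.I * x) - (1 + Complex.I * x - x ^ 2 / 2) with hr1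
    set r2 : ℝ := Real.exp (-(x ^ 2 / 2)) - 1 - -(x ^ 2 / 2) with hr2
    have hr1' : ‖r1‖ ≤ |x| ^ 3 := by
      have he : r1 = Complex.exp (Complex.I * x) -
          (0 + (Complex.I * x) ^ 0 / ((1 : ℕ) : ℂ) + (Complex.I * x) ^ 1 / (((0 + 1) * 1 : ℕ) : ℂ) +
          (Complex.I * x) ^ 2 / (((1 + 1) * ((0 + 1) * 1) : ℕ) : ℂ)) := by
        have hsq : (Complex.I * (x : ℂ)) ^ 2 = -(x : ℂ) ^ 2 := by rw [mul_pow, Complex.I_sq]; ring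
        rw [hr1, hsq]; push_cast; ring
      rw [he]
      refine h1.trans ?_
      have : 0 ≤ |x| ^ 3 := by positivity
      norm_num
      linarith
    have hr2' : ‖(r2 : ℂ)‖ ≤ |x| ^ 3 / 4 := by
      rw [Complex.norm_real, Real.norm_eq_abs]
      refine h2.trans ?_
      have h4 : |x| ^ 3 * |x| ≤ |x| ^ 3 * 1 := mul_le_mul_of_nonneg_left hx (by positivity)
      have : (-(x ^ 2 / 2)) ^ 2 = |x| ^ 3 * |x| / 4 := by
        have : |x| ^ 3 * |x| = (|x| ^ 2) ^ 2 := by ring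
        rw [this, sq_abs]; ring
      rw [this]; linarith
    have hexp : (Real.exp (-(x ^ 2 / 2)) : ℂ) = 1 - x ^ 2 / 2 + r2 := by
      rw [hr2]; push_cast; ring
    have hsplit : Complex.exp (Complex.I * x) - (1 + Complex.I * x) *
        (Real.exp (-(x ^ 2 / 2)) : ℂ) = r1 + Complex.I * (x : ℂ) ^ 3 / 2 -
          (1 + Complex.I * x) * r2 := by
      rw [hexp, hr1]; ring
    rw [hsplit]
    have hn1 : ‖Complex.I * (x : ℂ) ^ 3 / 2‖ = |x| ^ 3 / 2 := by simp
    have hn2 : ‖1 + Complex.I * (x : ℂ)‖ ≤ 2 := by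
      refine (norm_add_le _ _).trans ?_
      rw [hIx, norm_one]; linarith
    have hn3 : ‖(1 + Complex.I * (x : ℂ)) * r2‖ ≤ 2 * (|x| ^ 3 / 4) := by
      rw [norm_mul]
      exact mul_le_mul hn2 hr2' (norm_nonneg _) (by norm_num)
    refine (norm_sub_le _ _).trans ?_
    refine (add_le_add (norm_add_le _ _) le_rfl).trans ?_
    linarith
  · refine (norm_sub_le _ _).trans ?_
    have h1 : ‖Complex.exp (Complex.I * x)‖ = 1 := Complex.norm_exp_I_mul_ofReal x
    have h2 := Complex.norm_one_add_I_mul_mul_exp_le_one x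
    have h3 : 1 ≤ |x| ^ 3 := one_le_pow₀ hx.le
    linarith

lemma norm_prod_range_sub_prod_range_le {a b : ℕ → ℂ} (ha : ∀ k, ‖a k‖ ≤ 1) (hb : ∀ k, ‖b k‖ ≤ 1)
    (n : ℕ) : ‖∏ k ∈ Finset.range n, a k - ∏ k ∈ Finset.range n, b k‖ ≤
      ∑ k ∈ Finset.range n, ‖a k - b k‖ := by
  induction n with
  | zero => simp
  | succ n ih =>
    rw [Finset.prod_range_succ, Finset.prod_range_succ, Finset.sum_range_succ]
    have hP : ‖∏ k ∈ Finset.range n, b k‖ ≤ 1 := by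
      rw [norm_prod]
      exact Finset.prod_le_one (fun k _ => norm_nonneg _) fun k _ => hb k
    have : (∏ k ∈ Finset.range n, a k) * a n - (∏ k ∈ Finset.range n, b k) * b n =
        (∏ k ∈ Finset.range n, a k - ∏ k ∈ Finset.range n, b k) * a n +
          (∏ k ∈ Finset.range n, b k) * (a n - b n) := by ring
    rw [this]
    refine (norm_add_le _ _).trans (add_le_add ?_ ?_)
    · rw [norm_mul]
      exact (mul_le_of_le_one_right (norm_nonneg _) (ha n)).trans ih
    · rw [norm_mul]
      exact mul_le_of_le_one_left (norm_nonneg _) hP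

/-- Distributing the Gaussian factor over the product keeps every factor in the unit disc, so the
errors of the factors simply add. -/
lemma norm_exp_sum_sub_prod_le (t : ℝ) (x : ℕ → ℝ) (n : ℕ) :
    ‖Complex.exp (Complex.I * (t * ∑ k ∈ Finset.range n, x k : ℝ)) -
      (∏ k ∈ Finset.range n, (1 + Complex.I * (t * x k : ℝ))) *
        (Real.exp (-(t ^ 2 * (∑ k ∈ Finset.range n, x k ^ 2) / 2)) : ℂ)‖ ≤
      2 * |t| ^ 3 * ∑ k ∈ Finset.range n, |x k| ^ 3 := by
  have h1 : Complex.exp (Complex.I * (t * ∑ k ∈ Finset.range n, x k : ℝ)) =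
      ∏ k ∈ Finset.range n, Complex.exp (Complex.I * (t * x k : ℝ)) := by
    rw [← Complex.exp_sum, Finset.mul_sum, Complex.ofReal_sum, Finset.mul_sum]
  have h2 : (Real.exp (-(t ^ 2 * (∑ k ∈ Finset.range n, x k ^ 2) / 2)) : ℂ) =
      ∏ k ∈ Finset.range n, (Real.exp (-((t * x k) ^ 2 / 2)) : ℂ) := by
    rw [← Complex.ofReal_prod, ← Real.exp_sum, Finset.sum_neg_distrib, ← Finset.sum_div,
      Finset.mul_sum]
    simp_rw [mul_pow]
  rw [h1, h2, ← Finset.prod_mul_distrib]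
  refine (norm_prod_range_sub_prod_range_le (fun k => ?_) (fun k => ?_) n).trans ?_
  · exact (Complex.norm_exp_I_mul_ofReal _).le
  · exact Complex.norm_one_add_I_mul_mul_exp_le_one _
  · rw [Finset.mul_sum]
    refine Finset.sum_le_sum fun k _ => ?_
    refine (Complex.norm_exp_I_mul_sub_le (t * x k)).trans (le_of_eq ?_)
    rw [abs_mul]; ring

/-! ### The stopped product and its bounds. -/

/-- The sequence `x` stopped as soon as its quadratic variation exceeds `K`. -/
noncomputable def stoppedSeq (K : ℝ) (x : ℕ → ℝ) (k : ℕ) : ℝ :=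
  if ∑ j ∈ Finset.range k, x j ^ 2 ≤ K then x k else 0

/-- McLeish's product `∏ (1 + i t y_k)` over the stopped sequence `y`. -/
noncomputable def stoppedProd (K t : ℝ) (x : ℕ → ℝ) (n : ℕ) : ℂ :=
  ∏ k ∈ Finset.range n, (1 + Complex.I * (t * stoppedSeq K x k : ℝ))

lemma stoppedProd_succ (K t : ℝ) (x : ℕ → ℝ) (n : ℕ) :
    stoppedProd K t x (n + 1) =
      stoppedProd K t x n * (1 + Complex.I * (t * stoppedSeq K x n : ℝ)) :=
  Finset.prod_range_succ _ _

lemma stoppedProd_eq {K : ℝ} (t : ℝ) {x : ℕ → ℝ} {n : ℕ}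
    (h : ∑ j ∈ Finset.range n, x j ^ 2 ≤ K) :
    stoppedProd K t x n = ∏ k ∈ Finset.range n, (1 + Complex.I * (t * x k : ℝ)) := by
  refine Finset.prod_congr rfl fun k hk => ?_
  rw [stoppedSeq, if_pos]
  refine le_trans ?_ h
  exact Finset.sum_le_sum_of_subset_of_nonneg
    (Finset.range_mono (Finset.mem_range.1 hk).le) fun j _ _ => sq_nonneg _

/-- Since `1 + t²x² ≤ e^{t²x²}`, the factors before the crossing of `K` cost at most `e^{t²K}`. The
crossing factor is kept and costs `1 + t²R²`; all later factors are one. -/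
lemma norm_stoppedProd_sq_le {K R : ℝ} (t : ℝ) {x : ℕ → ℝ} {n : ℕ} (hK : 0 ≤ K)
    (hR : ∀ k < n, |x k| ≤ R) :
    ‖stoppedProd K t x n‖ ^ 2 ≤ Real.exp (t ^ 2 * K) * (1 + t ^ 2 * R ^ 2) := by
  suffices H : ∀ N ≤ n, (∑ j ∈ Finset.range N, x j ^ 2 ≤ K ∧
      ‖stoppedProd K t x N‖ ^ 2 ≤ Real.exp (t ^ 2 * ∑ j ∈ Finset.range N, x j ^ 2)) ∨
      (K < ∑ j ∈ Finset.range N, x j ^ 2 ∧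
        ‖stoppedProd K t x N‖ ^ 2 ≤ Real.exp (t ^ 2 * K) * (1 + t ^ 2 * R ^ 2)) by
    rcases H n le_rfl with ⟨h1, h2⟩ | ⟨-, h2⟩
    · refine h2.trans ?_
      have h3 : Real.exp (t ^ 2 * ∑ j ∈ Finset.range n, x j ^ 2) ≤ Real.exp (t ^ 2 * K) :=
        Real.exp_le_exp.2 (mul_le_mul_of_nonneg_left h1 (sq_nonneg t))
      refine h3.trans (le_mul_of_one_le_right (Real.exp_pos _).le ?_)
      have : 0 ≤ t ^ 2 * R ^ 2 := by positivity
      linarith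
    · exact h2
  intro N
  induction N with
  | zero => intro _; left; simp [stoppedProd, hK]
  | succ N ih =>
    intro hN
    rw [stoppedProd_succ, norm_mul, mul_pow, Complex.norm_one_add_I_mul_sq, mul_pow]
    rcases ih (by omega) with ⟨h1, h2⟩ | ⟨h1, h2⟩
    · rw [stoppedSeq, if_pos h1]
      have hstep : 1 + t ^ 2 * x N ^ 2 ≤ Real.exp (t ^ 2 * x N ^ 2) := by
        linarith [Real.add_one_le_exp (t ^ 2 * x N ^ 2)]
      have hpos : 0 ≤ 1 + t ^ 2 * x N ^ 2 := by positivity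
      rcases le_or_gt (∑ j ∈ Finset.range (N + 1), x j ^ 2) K with h3 | h3
      · refine Or.inl ⟨h3, ?_⟩
        rw [Finset.sum_range_succ, mul_add (t ^ 2), Real.exp_add]
        exact mul_le_mul h2 hstep hpos (Real.exp_pos _).le
      · refine Or.inr ⟨h3, mul_le_mul (h2.trans ?_) ?_ hpos (Real.exp_pos _).le⟩
        · exact Real.exp_le_exp.2 (mul_le_mul_of_nonneg_left h1 (sq_nonneg t))
        · have : x N ^ 2 ≤ R ^ 2 := by
            rw [← sq_abs]
            exact pow_le_pow_left₀ (abs_nonneg _) (hR N (by omega)) 2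
          have := mul_le_mul_of_nonneg_left this (sq_nonneg t)
          linarith
    · refine Or.inr ⟨?_, ?_⟩
      · rw [Finset.sum_range_succ]
        linarith [sq_nonneg (x N)]
      · rw [stoppedSeq, if_neg (not_le.2 h1)]
        simpa using h2

lemma norm_stoppedProd_le {K R : ℝ} (t : ℝ) {x : ℕ → ℝ} {n : ℕ} (hK : 0 ≤ K) (hR0 : 0 ≤ R)
    (hR : ∀ k < n, |x k| ≤ R) :
    ‖stoppedProd K t x n‖ ≤ Real.exp (t ^ 2 * K) * (1 + |t| * R) := by
  refine le_of_sq_le_sq ?_ (by positivity)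
  refine (norm_stoppedProd_sq_le t hK hR).trans ?_
  rw [mul_pow]
  have h1 : 1 ≤ Real.exp (t ^ 2 * K) := Real.one_le_exp (by positivity)
  have h2 : 0 ≤ |t| * R := by positivity
  have h3 : t ^ 2 * R ^ 2 = (|t| * R) ^ 2 := by rw [mul_pow, sq_abs]
  refine mul_le_mul ?_ ?_ (by positivity) (by positivity)
  · nlinarith
  · rw [h3]; nlinarith

lemma abs_exp_neg_sub_exp_neg_le {a b : ℝ} (ha : 0 ≤ a) (hb : 0 ≤ b) :
    |Real.exp (-a) - Real.exp (-b)| ≤ |a - b| := by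
  wlog hab : a ≤ b generalizing a b
  · rw [abs_sub_comm, abs_sub_comm a b]
    exact this hb ha (le_of_not_ge hab)
  have h1 : Real.exp (-b) ≤ Real.exp (-a) := Real.exp_le_exp.2 (by linarith)
  rw [abs_of_nonneg (by linarith), abs_sub_comm, abs_of_nonneg (by linarith)]
  have h2 : Real.exp (-b) = Real.exp (-a) * Real.exp (-(b - a)) := by
    rw [← Real.exp_add]; congr 1; ring
  have h3 : Real.exp (-a) ≤ 1 := Real.exp_le_one_iff.2 (by linarith)
  have h4 := Real.add_one_le_exp (-(b - a))
  have h5 := Real.exp_pos (-a)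
  rw [h2]
  nlinarith

lemma norm_exp_I_mul_sub_exp_I_mul_le (a b : ℝ) :
    ‖Complex.exp (Complex.I * a) - Complex.exp (Complex.I * b)‖ ≤ |a - b| := by
  have h : Complex.exp (Complex.I * a) - Complex.exp (Complex.I * b) =
      Complex.exp (Complex.I * b) * (Complex.exp (Complex.I * (a - b : ℝ)) - 1) := by
    rw [mul_sub, ← Complex.exp_add, mul_one]; congr 2; push_cast; ring
  rw [h, norm_mul, Complex.norm_exp_I_mul_ofReal, one_mul]
  exact Real.norm_exp_I_mul_ofReal_sub_one_le

/-- The comparison error between `e^{its}` and `e^{-t²v/2}` times McLeish's product, bounded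
uniformly over `|t| ≤ N`. -/
noncomputable def mcleishError (K v N B s : ℝ) (x : ℕ → ℝ) (n : ℕ) : ℝ :=
  if ∑ k ∈ Finset.range n, x k ^ 2 ≤ K then
    min (1 + B) (N * |s - ∑ k ∈ Finset.range n, x k| +
      2 * N ^ 3 * ∑ k ∈ Finset.range n, |x k| ^ 3 +
      B * (N ^ 2 * |∑ k ∈ Finset.range n, x k ^ 2 - v|))
  else 1 + B

lemma mcleishError_le (K v N B s : ℝ) (x : ℕ → ℝ) (n : ℕ) :
    mcleishError K v N B s x n ≤ 1 + B := by
  unfold mcleishError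
  split_ifs
  · exact min_le_left _ _
  · exact le_rfl

lemma mcleishError_nonneg {K v N B s : ℝ} {x : ℕ → ℝ} {n : ℕ} (hN : 0 ≤ N) (hB : 0 ≤ B) :
    0 ≤ mcleishError K v N B s x n := by
  unfold mcleishError
  split_ifs <;> positivity

/-- If the level `K` is not passed, stopping changes nothing and three errors add up: `s` against `∑
x_k`, exponential against product, `∑ x_k²` against `v`. Otherwise the trivial bound `1 + B` serves.
-/
lemma norm_exp_sub_stoppedProd_le {K v N B s t : ℝ} {x : ℕ → ℝ} {n : ℕ} (hv : 0 ≤ v)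
    (ht : |t| ≤ N) (hB : ‖stoppedProd K t x n‖ ≤ B) :
    ‖Complex.exp (Complex.I * (t * s : ℝ)) -
      stoppedProd K t x n * (Real.exp (-(t ^ 2 * v / 2)) : ℂ)‖ ≤ mcleishError K v N B s x n := by
  have htriv : ‖Complex.exp (Complex.I * (t * s : ℝ)) -
      stoppedProd K t x n * (Real.exp (-(t ^ 2 * v / 2)) : ℂ)‖ ≤ 1 + B := by
    refine (norm_sub_le _ _).trans (add_le_add (Complex.norm_exp_I_mul_ofReal _).le ?_)
    rw [norm_mul, Complex.norm_real, Real.norm_eq_abs, abs_of_pos (Real.exp_pos _)]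
    refine (mul_le_of_le_one_right (norm_nonneg _) ?_).trans hB
    refine Real.exp_le_one_iff.2 ?_
    have : 0 ≤ t ^ 2 * v := by positivity
    linarith
  unfold mcleishError
  split_ifs with h
  swap
  · exact htriv
  refine le_min htriv ?_
  have hN : 0 ≤ N := (abs_nonneg t).trans ht
  have hV : 0 ≤ ∑ k ∈ Finset.range n, x k ^ 2 := Finset.sum_nonneg fun k _ => sq_nonneg _
  have hB0 : 0 ≤ B := (norm_nonneg _).trans hB
  have e1 := norm_exp_I_mul_sub_exp_I_mul_le (t * s) (t * ∑ k ∈ Finset.range n, x k)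
  have e2 := norm_exp_sum_sub_prod_le t x n
  rw [← stoppedProd_eq t h] at e2
  have e3 : ‖stoppedProd K t x n * ((Real.exp (-(t ^ 2 * (∑ k ∈ Finset.range n, x k ^ 2) / 2)) : ℂ) -
      (Real.exp (-(t ^ 2 * v / 2)) : ℂ))‖ ≤
        B * (N ^ 2 * |∑ k ∈ Finset.range n, x k ^ 2 - v|) := by
    rw [norm_mul]
    refine mul_le_mul hB ?_ (norm_nonneg _) hB0
    rw [← Complex.ofReal_sub, Complex.norm_real, Real.norm_eq_abs]
    refine (abs_exp_neg_sub_exp_neg_le (by positivity) (by positivity)).trans ?_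
    have : t ^ 2 * (∑ k ∈ Finset.range n, x k ^ 2) / 2 - t ^ 2 * v / 2 =
        |t| ^ 2 / 2 * (∑ k ∈ Finset.range n, x k ^ 2 - v) := by rw [sq_abs]; ring
    rw [this, abs_mul, abs_of_nonneg (by positivity)]
    refine mul_le_mul_of_nonneg_right ?_ (abs_nonneg _)
    have := pow_le_pow_left₀ (abs_nonneg t) ht 2
    have h0 : 0 ≤ |t| ^ 2 := by positivity
    linarith
  rw [← mul_sub, abs_mul] at e1
  have e1' := e1.trans (mul_le_mul_of_nonneg_right ht (abs_nonneg _))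
  have e2' : 2 * |t| ^ 3 * ∑ k ∈ Finset.range n, |x k| ^ 3 ≤
      2 * N ^ 3 * ∑ k ∈ Finset.range n, |x k| ^ 3 := by
    refine mul_le_mul_of_nonneg_right ?_ (Finset.sum_nonneg fun k _ => by positivity)
    exact mul_le_mul_of_nonneg_left (pow_le_pow_left₀ (abs_nonneg t) ht 3) (by norm_num)
  have hsplit : ∀ a b c P : ℂ, ∀ u w : ℂ, a - P * w = (a - b) + (b - P * u) + P * (u - w) := by
    intros; ring
  rw [hsplit _ (Complex.exp (Complex.I * (t * ∑ k ∈ Finset.range n, x k : ℝ))) 0 _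
    (Real.exp (-(t ^ 2 * (∑ k ∈ Finset.range n, x k ^ 2) / 2)) : ℂ)]
  refine (norm_add_le _ _).trans (add_le_add ((norm_add_le _ _).trans (add_le_add e1' ?_)) e3)
  exact e2.trans e2'

/-! ### Conditional expectation of the stopped product. -/

section MartingaleDifference

variable {Ω : Type*} {mΩ : MeasurableSpace Ω} {μ : Measure Ω}

/-- Stopping is predictable: whether `x n` is kept depends only on earlier terms. This preserves the
martingale difference property. -/
lemma measurable_ite_sum_sq_le {𝓖 : Filtration ℕ mΩ} {x : ℕ → Ω → ℝ}
    (hx : ∀ k, Measurable[𝓖 (k + 1)] (x k)) (K : ℝ) (n : ℕ) :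
    Measurable[𝓖 n] fun ω => if ∑ j ∈ Finset.range n, x j ω ^ 2 ≤ K then (1 : ℝ) else 0 := by
  refine Measurable.ite ?_ measurable_const measurable_const
  refine measurableSet_le ?_ measurable_const
  refine Finset.measurable_sum _ fun j hj => ?_
  exact ((hx j).mono (𝓖.mono (Finset.mem_range.1 hj)) le_rfl).pow_const 2

lemma stoppedSeq_eq_mul (K : ℝ) (x : ℕ → ℝ) (n : ℕ) :
    stoppedSeq K x n = (if ∑ j ∈ Finset.range n, x j ^ 2 ≤ K then (1 : ℝ) else 0) * x n := by
  rw [stoppedSeq]; split_ifs <;> simp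

lemma measurable_stoppedProd {𝓖 : Filtration ℕ mΩ} {x : ℕ → Ω → ℝ}
    (hx : ∀ k, Measurable[𝓖 (k + 1)] (x k)) (K t : ℝ) (n : ℕ) :
    Measurable[𝓖 n] fun ω => stoppedProd K t (fun k => x k ω) n := by
  induction n with
  | zero => simp only [stoppedProd, Finset.range_zero, Finset.prod_empty]; exact measurable_const
  | succ n ih =>
    simp_rw [stoppedProd_succ, stoppedSeq_eq_mul]
    refine (ih.mono (𝓖.mono n.le_succ) le_rfl).mul ?_
    refine measurable_const.add (measurable_const.mul ?_)
    refine Complex.measurable_ofReal.comp (measurable_const.mul ?_)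
    exact ((measurable_ite_sum_sq_le hx K n).mono (𝓖.mono n.le_succ) le_rfl).mul (hx n)

lemma integrable_stoppedProd [IsFiniteMeasure μ] {𝓖 : Filtration ℕ mΩ} {x : ℕ → Ω → ℝ}
    (hx : ∀ k, Measurable[𝓖 (k + 1)] (x k)) (hint : ∀ k, Integrable (x k) μ) {K : ℝ} (hK : 0 ≤ K)
    (t : ℝ) (n : ℕ) : Integrable (fun ω => stoppedProd K t (fun k => x k ω) n) μ := by
  have hR : Integrable (fun ω => Real.exp (t ^ 2 * K) *
      (1 + |t| * ∑ k ∈ Finset.range n, |x k ω|)) μ :=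
    ((integrable_const 1).add
      ((integrable_finsetSum _ fun k _ => (hint k).abs).const_mul |t|)).const_mul _
  refine hR.mono' ((measurable_stoppedProd hx K t n).mono (𝓖.le n) le_rfl).aestronglyMeasurable
    (ae_of_all _ fun ω => ?_)
  refine norm_stoppedProd_le t hK (Finset.sum_nonneg fun k _ => abs_nonneg _) fun k hk => ?_
  exact Finset.single_le_sum (f := fun k => |x k ω|) (fun i _ => abs_nonneg _)
    (Finset.mem_range.2 hk)

/-- McLeish's product over martingale differences has conditional expectation one. -/
lemma condExp_stoppedProd [IsFiniteMeasure μ] {𝓖 : Filtration ℕ mΩ} {x : ℕ → Ω → ℝ}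
    (hx : ∀ k, Measurable[𝓖 (k + 1)] (x k)) (hint : ∀ k, Integrable (x k) μ)
    (hmd : ∀ k, μ[x k | 𝓖 k] =ᵐ[μ] 0) {K : ℝ} (hK : 0 ≤ K) (t : ℝ) (n : ℕ) :
    μ[fun ω => stoppedProd K t (fun k => x k ω) n | 𝓖 0] =ᵐ[μ] fun _ => 1 := by
  induction n with
  | zero =>
    simp only [stoppedProd, Finset.range_zero, Finset.prod_empty]
    exact (condExp_const (𝓖.le 0) (1 : ℂ)).eventuallyEq
  | succ n ih =>
    set P : ℕ → Ω → ℂ := fun n ω => stoppedProd K t (fun k => x k ω) n with hP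
    have hPint : ∀ n, Integrable (P n) μ := fun n => integrable_stoppedProd hx hint hK t n
    -- The increment of the product is `x n` times the `𝓖 n`-measurable `D`, so pulling `D` out
    -- makes its conditional expectation vanish.
    set D : Ω → ℂ := fun ω => P n ω * (Complex.I * t *
      ((if ∑ j ∈ Finset.range n, x j ω ^ 2 ≤ K then (1 : ℝ) else 0 : ℝ) : ℂ)) with hD
    have hDm : Measurable[𝓖 n] D := by
      refine (measurable_stoppedProd hx K t n).mul (measurable_const.mul ?_)
      exact Complex.measurable_ofReal.comp (measurable_ite_sum_sq_le hx K n)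
    have hstep : P (n + 1) = P n + x n • D := by
      funext ω
      simp only [hP, hD, stoppedProd_succ, stoppedSeq_eq_mul, Pi.add_apply, Pi.smul_apply',
        Complex.real_smul]
      push_cast
      ring
    -- `D` need not be bounded; integrability comes from the linear bound on the products at `n` and
    -- `n + 1`.
    have hxD : Integrable (x n • D) μ := by
      have : x n • D = P (n + 1) - P n := by rw [hstep]; ring
      rw [this]; exact (hPint _).sub (hPint _)
    have h1 : μ[x n • D | 𝓖 n] =ᵐ[μ] 0 := by
      filter_upwards [condExp_smul_of_aestronglyMeasurable_right (hint n) hxD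
        hDm.stronglyMeasurable.aestronglyMeasurable, hmd n] with ω h2 h3
      rw [h2, Pi.smul_apply', h3]
      simp
    have h2 : μ[x n • D | 𝓖 0] =ᵐ[μ] 0 := by
      refine (condExp_condExp_of_le (𝓖.mono (Nat.zero_le n)) (𝓖.le n)).symm.trans ?_
      refine (condExp_congr_ae h1).trans ?_
      rw [condExp_zero]
    have h3 := condExp_add (m := 𝓖 0) (hPint n) hxD
    rw [← hstep] at h3
    filter_upwards [h3, ih, h2] with ω a b c
    rw [a, Pi.add_apply, b, c]
    simp

lemma filtration_natCast_eq_comap_iterate {T : Ω → Ω} {𝓕 : Filtration ℤ mΩ}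
    (h𝓕 : ∀ i : ℤ, 𝓕 (i + 1) = MeasurableSpace.comap T (𝓕 i)) (k : ℕ) :
    𝓕 (k : ℤ) = MeasurableSpace.comap T^[k] (𝓕 0) := by
  induction k with
  | zero => simp [MeasurableSpace.comap_id]
  | succ k ih =>
    push_cast
    rw [h𝓕, ih, MeasurableSpace.comap_comp, Function.iterate_succ]

end MartingaleDifference

/-- If `E(h ∘ T | 𝓖) = 0` then `E(h ∘ T^{k+1} | T^{-k}𝓖) = 0`. -/
lemma condExp_iterate_eq_zero {Ω : Type*} {𝓖 mΩ : MeasurableSpace Ω} {μ : Measure Ω}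
    [IsFiniteMeasure μ] (h𝓖 : 𝓖 ≤ mΩ)
    {T : Ω → Ω} (hT : MeasurePreserving T μ μ) {h : Ω → ℝ} (hh : Integrable h μ)
    (h0 : μ[h ∘ T | 𝓖] =ᵐ[μ] 0) (k : ℕ) :
    μ[fun ω => h (T^[k + 1] ω) | MeasurableSpace.comap T^[k] 𝓖] =ᵐ[μ] 0 := by
  have hTk := hT.iterate k
  have hle : MeasurableSpace.comap T^[k] 𝓖 ≤ mΩ :=
    (MeasurableSpace.comap_mono h𝓖).trans hTk.measurable.comap_le
  have hhT : Integrable (h ∘ T) μ := hT.integrable_comp_of_integrable hh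
  refine (ae_eq_condExp_of_forall_setIntegral_eq hle
    ((hT.iterate (k + 1)).integrable_comp_of_integrable hh)
    (fun _ _ _ => (integrable_zero _ _ _).integrableOn) ?_
    (@stronglyMeasurable_zero _ _ (_) _ _).aestronglyMeasurable).symm
  -- Every set of the pulled-back σ-algebra is `T^{-k} B`, and invariance moves the integral back to
  -- `B`.
  rintro _ ⟨B, hB, rfl⟩ -
  have h1 : ∫ ω in B, (h ∘ T) ω ∂μ = 0 := by
    rw [← setIntegral_condExp h𝓖 hhT hB, setIntegral_congr_ae (h𝓖 B hB)
      (g := fun _ => (0 : ℝ)) (h0.mono fun ω hω _ => hω)]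
    simp
  have h2 : ∫ ω in B, (h ∘ T) ω ∂(μ.map T^[k]) =
      ∫ ω in T^[k] ⁻¹' B, (h ∘ T) (T^[k] ω) ∂μ :=
    setIntegral_map (h𝓖 B hB) (by rw [hTk.map_eq]; exact hhT.aestronglyMeasurable)
      hTk.measurable.aemeasurable
  rw [hTk.map_eq, h1] at h2
  simp only [Pi.zero_apply, integral_zero, Function.iterate_succ_apply', Function.comp_apply]
    at h2 ⊢
  exact h2

/-! ### Pathwise convergence of the comparison error. -/

/-- Late terms satisfy `|a k| ≤ ε √(k+1) ≤ ε √n`; the finitely many early ones are absorbed as `√n →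
∞`. -/
lemma eventually_forall_lt_abs_le_mul_sqrt {a : ℕ → ℝ}
    (ha : Tendsto (fun k : ℕ => |a k| / √((k : ℝ) + 1)) atTop (𝓝 0)) {ε : ℝ} (hε : 0 < ε) :
    ∀ᶠ n : ℕ in atTop, ∀ k < n, |a k| ≤ ε * √(n : ℝ) := by
  obtain ⟨k₀, hk₀⟩ := eventually_atTop.1 (ha.eventually_le_const hε)
  have hsqrt : Tendsto (fun n : ℕ => ε * √(n : ℝ)) atTop atTop :=
    (Real.tendsto_sqrt_atTop.comp tendsto_natCast_atTop_atTop).const_mul_atTop hε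
  have hfin : ∀ᶠ n : ℕ in atTop, ∀ k ∈ Finset.range k₀, |a k| ≤ ε * √(n : ℝ) :=
    (Filter.eventually_all_finset _).2 fun k _ => hsqrt.eventually_ge_atTop _
  filter_upwards [hfin] with n hn k hk
  rcases lt_or_ge k k₀ with h | h
  · exact hn k (Finset.mem_range.2 h)
  · have h1 := hk₀ k h
    rw [div_le_iff₀ (Real.sqrt_pos.2 (by positivity))] at h1
    refine h1.trans (mul_le_mul_of_nonneg_left (Real.sqrt_le_sqrt ?_) hε.le)
    exact_mod_cast hk

/-- The cubic sum is at most the largest term times the quadratic sum. -/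
lemma tendsto_sum_abs_div_sqrt_cube {a : ℕ → ℝ} {v : ℝ}
    (ha : Tendsto (fun k : ℕ => |a k| / √((k : ℝ) + 1)) atTop (𝓝 0))
    (hV : Tendsto (fun n : ℕ => ∑ k ∈ Finset.range n, (a k / √(n : ℝ)) ^ 2) atTop (𝓝 v)) :
    Tendsto (fun n : ℕ => ∑ k ∈ Finset.range n, |a k / √(n : ℝ)| ^ 3) atTop (𝓝 0) := by
  have hv : 0 ≤ v := ge_of_tendsto' hV fun n => Finset.sum_nonneg fun k _ => sq_nonneg _
  rw [Metric.tendsto_atTop']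
  intro ε hε
  have hδ : 0 < ε / (2 * (v + 1)) := by positivity
  obtain ⟨n₀, hn₀⟩ := eventually_atTop.1 ((eventually_forall_lt_abs_le_mul_sqrt ha hδ).and
    ((hV.eventually_le_const (lt_add_one v)).and (eventually_gt_atTop 0)))
  refine ⟨n₀, fun n hn => ?_⟩
  obtain ⟨h1, h2, h3⟩ := hn₀ n hn.le
  have hs : 0 < √(n : ℝ) := Real.sqrt_pos.2 (by exact_mod_cast h3)
  rw [Real.dist_0_eq_abs, abs_of_nonneg (Finset.sum_nonneg fun k _ => by positivity)]
  calc ∑ k ∈ Finset.range n, |a k / √(n : ℝ)| ^ 3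
      ≤ ∑ k ∈ Finset.range n, ε / (2 * (v + 1)) * (a k / √(n : ℝ)) ^ 2 := by
        refine Finset.sum_le_sum fun k hk => ?_
        have h4 : |a k / √(n : ℝ)| ≤ ε / (2 * (v + 1)) := by
          rw [abs_div, abs_of_pos hs, div_le_iff₀ hs]
          exact h1 k (Finset.mem_range.1 hk)
        rw [pow_succ', ← sq_abs (a k / √(n : ℝ))]
        exact mul_le_mul_of_nonneg_right h4 (sq_nonneg _)
    _ = ε / (2 * (v + 1)) * ∑ k ∈ Finset.range n, (a k / √(n : ℝ)) ^ 2 := by rw [Finset.mul_sum]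
    _ ≤ ε / (2 * (v + 1)) * (v + 1) := mul_le_mul_of_nonneg_left h2 hδ.le
    _ = ε / 2 := by field_simp
    _ < ε := half_lt_self hε

/-- As `v < K`, the level is eventually not passed, and the three errors vanish separately. -/
lemma tendsto_mcleishError {a s : ℕ → ℝ} {K v N B : ℝ} (hN : 0 ≤ N) (hB : 0 ≤ B) (hvK : v < K)
    (ha : Tendsto (fun k : ℕ => |a k| / √((k : ℝ) + 1)) atTop (𝓝 0))
    (hV : Tendsto (fun n : ℕ => ∑ k ∈ Finset.range n, (a k / √(n : ℝ)) ^ 2) atTop (𝓝 v))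
    (hs : Tendsto (fun n : ℕ => s n - ∑ k ∈ Finset.range n, a k / √(n : ℝ)) atTop (𝓝 0)) :
    Tendsto (fun n : ℕ => mcleishError K v N B (s n) (fun k => a k / √(n : ℝ)) n) atTop
      (𝓝 0) := by
  have hlim : Tendsto (fun n : ℕ => N * |s n - ∑ k ∈ Finset.range n, a k / √(n : ℝ)| +
      2 * N ^ 3 * ∑ k ∈ Finset.range n, |a k / √(n : ℝ)| ^ 3 +
      B * (N ^ 2 * |∑ k ∈ Finset.range n, (a k / √(n : ℝ)) ^ 2 - v|)) atTop
      (𝓝 (N * |0| + 2 * N ^ 3 * 0 + B * (N ^ 2 * |v - v|))) :=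
    ((hs.abs.const_mul N).add ((tendsto_sum_abs_div_sqrt_cube ha hV).const_mul _)).add
      (((hV.sub_const v).abs.const_mul _).const_mul _)
  simp only [abs_zero, mul_zero, sub_self, add_zero] at hlim
  refine squeeze_zero' (Eventually.of_forall fun n => mcleishError_nonneg hN hB) ?_ hlim
  filter_upwards [hV.eventually_le_const hvK] with n hn
  rw [mcleishError, if_pos hn]
  exact min_le_right _ _

lemma measurable_mcleishError {Ω : Type*} {mΩ : MeasurableSpace Ω} {B s : Ω → ℝ} {x : ℕ → Ω → ℝ}
    (hB : Measurable B) (hs : Measurable s) (hx : ∀ k, Measurable (x k)) (K v N : ℝ) (n : ℕ) :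
    Measurable fun ω => mcleishError K v N (B ω) (s ω) (fun k => x k ω) n := by
  unfold mcleishError
  have hV : Measurable fun ω => ∑ k ∈ Finset.range n, x k ω ^ 2 :=
    Finset.measurable_sum _ fun k _ => (hx k).pow_const 2
  have hS : Measurable fun ω => ∑ k ∈ Finset.range n, x k ω :=
    Finset.measurable_sum _ fun k _ => hx k
  have hC : Measurable fun ω => ∑ k ∈ Finset.range n, |x k ω| ^ 3 :=
    Finset.measurable_sum _ fun k _ => (hx k).abs.pow_const 3
  refine Measurable.ite (measurableSet_le hV measurable_const) ?_ (hB.const_add 1)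
  exact (hB.const_add 1).min ((((hs.sub hS).abs.const_mul N).add (hC.const_mul _)).add
    (hB.mul ((hV.sub_const v).abs.const_mul _)))

/-! ### Characteristic functions of regular conditional laws. -/

section CondDistrib

/-- Probability measures `ν a` that form a version of the conditional law of `Y` given `X` agree
almost surely with the regular conditional distribution. -/
lemma ae_eq_condDistrib {α β : Type*} {mα : MeasurableSpace α} {mβ : MeasurableSpace β}
    {μ : Measure α} [IsFiniteMeasure μ] {X : α → β} {Y : α → ℝ} (hX : Measurable X)
    (hY : Measurable Y) {ν : α → Measure ℝ} (hν : ∀ a, IsProbabilityMeasure (ν a))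
    (h : ∀ s, MeasurableSet s →
      (fun a => (ν a).real s) =ᵐ[μ] μ[(Y ⁻¹' s).indicator (fun _ => (1 : ℝ)) | mβ.comap X]) :
    ∀ᵐ a ∂μ, ν a = condDistrib Y X μ (X a) := by
  -- Rational intervals are countable, giving a single null set, and they determine the measure.
  have key : ∀ᵐ a ∂μ, ∀ p q : ℚ, (ν a).real (Set.Ioo p q) =
      (condDistrib Y X μ (X a)).real (Set.Ioo p q) :=
    ae_all_iff.2 fun p => ae_all_iff.2 fun q =>
      (h _ measurableSet_Ioo).trans (condDistrib_ae_eq_condExp hX hY measurableSet_Ioo).symm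
  filter_upwards [key] with a ha
  exact Real.measure_ext_Ioo_rat fun p q => (measureReal_eq_measureReal_iff).1 (ha p q)

lemma ae_charFun_eq_condExp_comap {α β : Type*} {mα : MeasurableSpace α} {mβ : MeasurableSpace β}
    {μ : Measure α} [IsFiniteMeasure μ] {X : α → β} {Y : α → ℝ} (hX : Measurable X)
    (hY : Measurable Y) {ν : α → Measure ℝ} (hν : ∀ a, IsProbabilityMeasure (ν a))
    (h : ∀ s, MeasurableSet s →
      (fun a => (ν a).real s) =ᵐ[μ] μ[(Y ⁻¹' s).indicator (fun _ => (1 : ℝ)) | mβ.comap X])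
    (t : ℝ) :
    ∀ᵐ a ∂μ, charFun (ν a) t =
      (μ[fun a => Complex.exp (Complex.I * (t * Y a : ℝ)) | mβ.comap X]) a := by
  have hm : Measurable fun y : ℝ => Complex.exp (Complex.I * (t * y : ℝ)) := by fun_prop
  have hint : Integrable (fun a => Complex.exp (Complex.I * (t * Y a : ℝ))) μ :=
    (integrable_const (1 : ℝ)).mono' (hm.comp hY).aestronglyMeasurable
      (ae_of_all _ fun a => (Complex.norm_exp_I_mul_ofReal _).le)
  filter_upwards [ae_eq_condDistrib hX hY hν h,
    condExp_ae_eq_integral_condDistrib hX hY.aemeasurable hm.stronglyMeasurable hint] with a h1 h2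
  rw [h2, charFun_apply_real, h1]
  refine integral_congr_ae (ae_of_all _ fun y => ?_)
  simp only
  congr 1
  push_cast
  ring

/-- Conditioning on `𝓖` is conditioning on the identity map into `(Ω, 𝓖)`. -/
lemma ae_charFun_eq_condExp {Ω : Type*} {mΩ : MeasurableSpace Ω} {μ : Measure Ω}
    [IsFiniteMeasure μ] {𝓖 : MeasurableSpace Ω} (h𝓖 : 𝓖 ≤ mΩ) {Y : Ω → ℝ}
    (hY : Measurable[mΩ] Y) {ν : Ω → Measure ℝ} (hν : ∀ a, IsProbabilityMeasure (ν a))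
    (h : ∀ s, MeasurableSet s →
      (fun a => (ν a).real s) =ᵐ[μ] μ[(Y ⁻¹' s).indicator (fun _ => (1 : ℝ)) | 𝓖]) (t : ℝ) :
    ∀ᵐ a ∂μ, charFun (ν a) t =
      (μ[fun a => Complex.exp (Complex.I * (t * Y a : ℝ)) | 𝓖]) a := by
  have hX : @Measurable Ω Ω mΩ 𝓖 id := measurable_id.mono le_rfl h𝓖
  have := @ae_charFun_eq_condExp_comap Ω Ω mΩ 𝓖 μ _ id Y hX hY ν hν
  rw [MeasurableSpace.comap_id] at this
  exact this h t

end CondDistrib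

/-! ### From characteristic functions to distribution functions. -/

section WeakConvergence

/-- Convergence in characteristic function at a locally uniform rate over the rationals implies
weak convergence. -/
lemma MeasureTheory.ProbabilityMeasure.tendsto_of_charFun_rat {ν : ℕ → ProbabilityMeasure ℝ}
    {ν₀ : ProbabilityMeasure ℝ}
    (h : ∀ N : ℕ, ∃ ε : ℕ → ℝ, Tendsto ε atTop (𝓝 0) ∧ ∀ n, ∀ q : ℚ, |(q : ℝ)| ≤ N →
      ‖charFun (ν n : Measure ℝ) (q : ℝ) - charFun (ν₀ : Measure ℝ) (q : ℝ)‖ ≤ ε n) :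
    Tendsto ν atTop (𝓝 ν₀) := by
  refine ProbabilityMeasure.tendsto_iff_tendsto_charFun.2 fun t => ?_
  obtain ⟨N, hN⟩ := exists_nat_gt |t|
  obtain ⟨ε, hε, hb⟩ := h N
  rw [tendsto_iff_norm_sub_tendsto_zero]
  refine squeeze_zero (fun n => norm_nonneg _) (fun n => ?_) hε
  -- By continuity the bound passes from the rationals of `(-N, N)` to `t`.
  have hclosed : IsClosed {u : ℝ | ‖charFun (ν n : Measure ℝ) u - charFun (ν₀ : Measure ℝ) u‖
      ≤ ε n} := by
    refine isClosed_le ?_ continuous_const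
    exact (continuous_charFun.sub continuous_charFun).norm
  have hsub : Set.Ioo (-(N : ℝ)) N ∩ Set.range ((↑) : ℚ → ℝ) ⊆
      {u : ℝ | ‖charFun (ν n : Measure ℝ) u - charFun (ν₀ : Measure ℝ) u‖ ≤ ε n} := by
    rintro _ ⟨hu, q, rfl⟩
    exact hb n q (abs_le.2 ⟨hu.1.le, hu.2.le⟩)
  exact hclosed.closure_subset_iff.2 hsub
    (Dense.open_subset_closure_inter Rat.denseRange_cast isOpen_Ioo (abs_lt.1 hN))

lemma measure_singleton_eq_zero_of_continuousAt_cdf {ν : Measure ℝ} [IsProbabilityMeasure ν]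
    {z : ℝ} (hz : ContinuousAt (fun z => cdf ν z) z) : ν {z} = 0 := by
  rw [← measure_cdf ν, StieltjesFunction.measure_singleton, ENNReal.ofReal_eq_zero]
  have : Function.leftLim (cdf ν) z = cdf ν z :=
    leftLim_eq_of_tendsto (hz.tendsto.mono_left nhdsWithin_le_nhds)
  rw [this, sub_self]

lemma MeasureTheory.ProbabilityMeasure.tendsto_real_Iic {ν : ℕ → ProbabilityMeasure ℝ}
    {ν₀ : ProbabilityMeasure ℝ} (h : Tendsto ν atTop (𝓝 ν₀)) {z : ℝ}
    (hz : ContinuousAt (fun z => cdf (ν₀ : Measure ℝ) z) z) :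
    Tendsto (fun n => (ν n : Measure ℝ).real (Set.Iic z)) atTop
      (𝓝 (cdf (ν₀ : Measure ℝ) z)) := by
  rw [cdf_eq_real]
  refine (ENNReal.tendsto_toReal (measure_ne_top _ _)).comp
    (ProbabilityMeasure.tendsto_measure_of_null_frontier_of_tendsto' h ?_)
  rw [frontier_Iic]
  exact measure_singleton_eq_zero_of_continuousAt_cdf hz

end WeakConvergence

/-! ### The conditional central limit theorem. -/

section Main

variable {Ω : Type*} {mΩ : MeasurableSpace Ω} {μ : Measure Ω}

lemma ae_birkhoffPartialSum_eq {T : Ω → Ω} (hT : Measure.QuasiMeasurePreserving T μ μ)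
    {f m g : Ω → ℝ} (hfmg : f =ᵐ[μ] fun ω => m ω + g ω - g (T ω)) :
    ∀ᵐ ω ∂μ, ∀ n, birkhoffPartialSum T f n ω =
      ∑ k ∈ Finset.range n, m (T^[k + 1] ω) + (g (T ω) - g (T^[n + 1] ω)) := by
  have hall : ∀ᵐ ω ∂μ, ∀ k : ℕ, f (T^[k + 1] ω) =
      m (T^[k + 1] ω) + g (T^[k + 1] ω) - g (T^[k + 2] ω) :=
    ae_all_iff.2 fun k => ((hT.iterate (k + 1)).ae hfmg).mono fun ω hω => by
      rw [hω, Function.iterate_succ_apply' T (k + 1)]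
  filter_upwards [hall] with ω hω n
  rw [birkhoffPartialSum, Finset.range_eq_Ico, Finset.sum_Ico_add' (fun k => m (T^[k] ω)) 0 n 1]
  induction n with
  | zero => simp
  | succ n ih =>
    rw [Finset.sum_Icc_succ_top (by omega), Finset.sum_Ico_succ_top (by omega), ih, hω n]
    ring

lemma ae_tendsto_martingale_coboundary [IsProbabilityMeasure μ] {T : Ω → Ω} (hT : Ergodic T μ)
    {f m g : Ω → ℝ} (hm : MemLp m 2 μ) (hg : MemLp g 2 μ)
    (hfmg : f =ᵐ[μ] fun ω => m ω + g ω - g (T ω)) :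
    ∀ᵐ ω ∂μ, Tendsto (fun k : ℕ => |m (T^[k + 1] ω)| / √((k : ℝ) + 1)) atTop (𝓝 0) ∧
      Tendsto (fun n : ℕ => ∑ k ∈ Finset.range n, (m (T^[k + 1] ω) / √(n : ℝ)) ^ 2) atTop
        (𝓝 (∫ ω, m ω ^ 2 ∂μ)) ∧
      Tendsto (fun n : ℕ => birkhoffPartialSum T f n ω / √(n : ℝ) -
        ∑ k ∈ Finset.range n, m (T^[k + 1] ω) / √(n : ℝ)) atTop (𝓝 0) := by
  filter_upwards [hT.ae_tendsto_iterate_div_sqrt hm,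
    -- Evaluated at `T ω`, because the sums start at the first iterate.
    hT.quasiMeasurePreserving.ae (hT.ae_tendsto_birkhoffSum_div hm.integrable_sq),
    hT.quasiMeasurePreserving.ae (hT.ae_tendsto_iterate_div_sqrt hg),
    ae_birkhoffPartialSum_eq hT.quasiMeasurePreserving hfmg] with ω h1 h2 h3 h4
  refine ⟨?_, ?_, ?_⟩
  · have := h1.comp (tendsto_add_atTop_nat 1)
    refine this.congr fun k => ?_
    simp
  · refine h2.congr fun n => ?_
    simp_rw [div_pow, Real.sq_sqrt (Nat.cast_nonneg n), birkhoffSum, ← Finset.sum_div]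
    simp [Function.iterate_succ_apply]
  · have h5 : Tendsto (fun n : ℕ => |g (T ω)| / √(n : ℝ)) atTop (𝓝 0) :=
      tendsto_const_nhds.div_atTop (Real.tendsto_sqrt_atTop.comp tendsto_natCast_atTop_atTop)
    have h6 := h5.add h3
    rw [add_zero] at h6
    refine squeeze_zero_norm (fun n => ?_) h6
    rw [h4 n, ← Finset.sum_div, ← sub_div, add_sub_cancel_left, norm_div, Real.norm_eq_abs,
      Real.norm_eq_abs, abs_of_nonneg (Real.sqrt_nonneg _), ← add_div]
    exact div_le_div_of_nonneg_right (abs_sub _ _) (Real.sqrt_nonneg _)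

/-- The conditional characteristic functions given `𝓕₀` converge almost surely to the Gaussian
characteristic function, uniformly over rational arguments in a bounded interval. -/
lemma ae_condExp_exp_sub_le [IsProbabilityMeasure μ] {T : Ω → Ω} (hT : Ergodic T μ)
    {𝓕 : Filtration ℤ mΩ} (h𝓕 : ∀ i : ℤ, 𝓕 (i + 1) = MeasurableSpace.comap T (𝓕 i))
    {f m g : Ω → ℝ} (hf : Measurable f) (hm : m ∈ martingaleDifferenceSpace μ (𝓕 0) T)
    (hg : MemLp g 2 μ) (hfmg : f =ᵐ[μ] fun ω => m ω + g ω - g (T ω)) (N : ℕ) :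
    ∀ᵐ ω ∂μ, ∃ ε : ℕ → ℝ, Tendsto ε atTop (𝓝 0) ∧ ∀ n, ∀ q : ℚ, |(q : ℝ)| ≤ N →
      ‖(μ[fun ω => Complex.exp (Complex.I *
          ((q : ℝ) * (birkhoffPartialSum T f n ω / √(n : ℝ)) : ℝ)) | 𝓕 0]) ω -
        (Real.exp (-((q : ℝ) ^ 2 * (∫ ω, m ω ^ 2 ∂μ) / 2)) : ℂ)‖ ≤ ε n := by
  obtain ⟨hm𝓕, hm2, hm0⟩ := hm
  have hmm : Measurable m := hm𝓕.mono (𝓕.le 0) le_rfl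
  set v : ℝ := ∫ ω, m ω ^ 2 ∂μ with hv
  have hv0 : 0 ≤ v := integral_nonneg fun ω => sq_nonneg _
  have hK : 0 ≤ v + 1 := by linarith
  obtain ⟨R, hRm, hRint, hR0, hR⟩ :=
    hT.toMeasurePreserving.exists_integrable_bound_iterate hmm hm2
  let 𝓖 : Filtration ℕ mΩ :=
    ⟨fun k => 𝓕 k, fun i j hij => 𝓕.mono (by exact_mod_cast hij), fun k => 𝓕.le k⟩
  have hiter : ∀ k, Measurable (T^[k]) := fun k => hT.measurable.iterate k
  set x : ℕ → ℕ → Ω → ℝ := fun n k ω => m (T^[k + 1] ω) / √(n : ℝ) with hx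
  have hxm : ∀ n k, Measurable[𝓖 (k + 1)] (x n k) := fun n k => by
    refine Measurable.div_const ?_ _
    have : 𝓖 (k + 1) = MeasurableSpace.comap T^[k + 1] (𝓕 0) :=
      filtration_natCast_eq_comap_iterate h𝓕 (k + 1)
    rw [this]
    exact hm𝓕.comp (Measurable.of_comap_le le_rfl)
  have hmint : Integrable m μ := hm2.integrable one_le_two
  have hxint : ∀ n k, Integrable (x n k) μ := fun n k =>
    ((hT.toMeasurePreserving.iterate (k + 1)).integrable_comp_of_integrable hmint).div_const _
  have hxmd : ∀ n k, μ[x n k | 𝓖 k] =ᵐ[μ] 0 := fun n k => by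
    have h1 : μ[fun ω => m (T^[k + 1] ω) | 𝓖 k] =ᵐ[μ] 0 := by
      have : 𝓖 k = MeasurableSpace.comap T^[k] (𝓕 0) :=
        filtration_natCast_eq_comap_iterate h𝓕 k
      rw [this]
      exact condExp_iterate_eq_zero (𝓕.le 0) hT.toMeasurePreserving hmint hm0 k
    have h2 : x n k = (√(n : ℝ))⁻¹ • fun ω => m (T^[k + 1] ω) := by
      funext ω
      simp only [hx, Pi.smul_apply, smul_eq_mul, div_eq_inv_mul]
    rw [h2]
    filter_upwards [condExp_smul (μ := μ) (√(n : ℝ))⁻¹ (fun ω => m (T^[k + 1] ω)) (𝓖 k), h1]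
      with ω a b
    rw [a, Pi.smul_apply, b]
    simp
  -- The bound of `norm_stoppedProd_le` at the worst `|t| = N`: integrable, and independent of both
  -- `n` and `q`.
  set B : Ω → ℝ := fun ω => Real.exp ((N : ℝ) ^ 2 * (v + 1)) * (1 + N * R ω) with hB
  have hBm : Measurable B := ((hRm.const_mul _).const_add 1).const_mul _
  have hBint : Integrable B μ := ((integrable_const 1).add (hRint.const_mul _)).const_mul _
  have hB0 : ∀ ω, 0 ≤ B ω := fun ω => by have := hR0 ω; positivity
  set s : ℕ → Ω → ℝ := fun n ω => birkhoffPartialSum T f n ω / √(n : ℝ) with hs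
  have hsm : ∀ n, Measurable (s n) := fun n =>
    (Finset.measurable_sum _ fun k _ => hf.comp (hiter k)).div_const _
  set H : ℕ → Ω → ℝ := fun n ω =>
    mcleishError (v + 1) v N (B ω) (s n ω) (fun k => x n k ω) n with hH
  have hHm : ∀ n, Measurable (H n) := fun n => measurable_mcleishError hBm (hsm n)
    (fun k => (hxm n k).mono (𝓖.le _) le_rfl) _ _ _ n
  have hH0 : ∀ n ω, 0 ≤ H n ω := fun n ω => mcleishError_nonneg (Nat.cast_nonneg N) (hB0 ω)
  have hHB : ∀ n ω, H n ω ≤ 1 + B ω := fun n ω => mcleishError_le _ _ _ _ _ _ _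
  have hBint1 : Integrable (fun ω => 1 + B ω) μ := (integrable_const 1).add hBint
  have hHint : ∀ n, Integrable (H n) μ := fun n =>
    hBint1.mono' (hHm n).aestronglyMeasurable (ae_of_all _ fun ω => by
      rw [Real.norm_eq_abs, abs_of_nonneg (hH0 n ω)]; exact hHB n ω)
  have hHlim : ∀ᵐ ω ∂μ, Tendsto (fun n => H n ω) atTop (𝓝 0) := by
    filter_upwards [ae_tendsto_martingale_coboundary hT hm2 hg hfmg] with ω hω
    exact tendsto_mcleishError (Nat.cast_nonneg N) (hB0 ω) (lt_add_one v) hω.1 hω.2.1 hω.2.2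
  have hEH := ae_tendsto_condExp_zero_of_dominated (𝓕.le 0) hHm hBint1 hH0 hHB hHlim
  have hbound : ∀ᵐ ω ∂μ, ∀ n, ∀ q : ℚ, |(q : ℝ)| ≤ N →
      ‖(μ[fun ω => Complex.exp (Complex.I * ((q : ℝ) * s n ω : ℝ)) | 𝓕 0]) ω -
        (Real.exp (-((q : ℝ) ^ 2 * v / 2)) : ℂ)‖ ≤ (μ[H n | 𝓕 0]) ω := by
    refine ae_all_iff.2 fun n => ae_all_iff.2 fun q => ?_
    by_cases hq : |(q : ℝ)| ≤ N
    swap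
    · exact ae_of_all _ fun ω h => absurd h hq
    set c : ℝ := Real.exp (-((q : ℝ) ^ 2 * v / 2)) with hc
    set E : Ω → ℂ := fun ω => Complex.exp (Complex.I * ((q : ℝ) * s n ω : ℝ)) with hE
    set P : Ω → ℂ := fun ω => stoppedProd (v + 1) q (fun k => x n k ω) n with hP
    have hPint : Integrable P μ := integrable_stoppedProd (hxm n) (hxint n) hK q n
    have hEint : Integrable E μ :=
      (integrable_const (1 : ℝ)).mono' (Complex.measurable_exp.comp (measurable_const.mul
        (Complex.measurable_ofReal.comp ((hsm n).const_mul _)))).aestronglyMeasurable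
        (ae_of_all _ fun ω => (Complex.norm_exp_I_mul_ofReal _).le)
    -- Since `P` has conditional expectation one, conditioning `E - c • P` yields exactly the
    -- difference to be bounded.
    have hZ : ∀ᵐ ω ∂μ, ‖(E - c • P) ω‖ ≤ H n ω := by
      filter_upwards [hR] with ω hω
      have hxR : ∀ k < n, |x n k ω| ≤ R ω := fun k hk => by
        have hn : 0 < √(n : ℝ) := Real.sqrt_pos.2 (by exact_mod_cast (Nat.zero_le k).trans_lt hk)
        rw [hx, abs_div, abs_of_pos hn, div_le_iff₀ hn]
        refine (hω k).trans (mul_le_mul_of_nonneg_left (Real.sqrt_le_sqrt ?_) (hR0 ω))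
        exact_mod_cast hk
      have hPB : ‖P ω‖ ≤ B ω := by
        refine (norm_stoppedProd_le q hK (hR0 ω) hxR).trans ?_
        have h0 := hR0 ω
        have hq2 : (q : ℝ) ^ 2 ≤ (N : ℝ) ^ 2 := by
          rw [← sq_abs (q : ℝ)]; exact pow_le_pow_left₀ (abs_nonneg _) hq 2
        refine mul_le_mul ?_ ?_ (by positivity) (Real.exp_pos _).le
        · exact Real.exp_le_exp.2 (mul_le_mul_of_nonneg_right hq2 hK)
        · have := mul_le_mul_of_nonneg_right hq h0
          linarith
      have := norm_exp_sub_stoppedProd_le (s := s n ω) hv0 hq hPB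
      rw [Pi.sub_apply, Pi.smul_apply, Complex.real_smul, mul_comm]
      exact this
    filter_upwards [condExp_sub hEint (hPint.smul c) (𝓕 0), condExp_smul c P (𝓕 0) (μ := μ),
      condExp_stoppedProd (hxm n) (hxint n) (hxmd n) hK q n, norm_condExp_le (m := 𝓕 0) (μ := μ)
        (E - c • P), condExp_mono (m := 𝓕 0) (hEint.sub (hPint.smul c)).norm (hHint n) hZ]
      with ω h1 h2 h3 h4 h5 _
    have h3' : (μ[P | 𝓕 0]) ω = 1 := h3
    have h6 : (μ[E - c • P | 𝓕 0]) ω = (μ[E | 𝓕 0]) ω - (c : ℂ) := by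
      rw [h1, Pi.sub_apply, h2, Pi.smul_apply, h3', Complex.real_smul, mul_one]
    rw [← h6]
    exact h4.trans h5
  filter_upwards [hEH, hbound] with ω h1 h2
  exact ⟨fun n => (μ[H n | 𝓕 0]) ω, h1, h2⟩

lemma coe_toNNReal_eLpNorm_two_sq {m : Ω → ℝ} (hm : MemLp m 2 μ) :
    (((eLpNorm m 2 μ).toNNReal ^ 2 : NNReal) : ℝ) = ∫ ω, m ω ^ 2 ∂μ := by
  have h0 : 0 ≤ ∫ ω, m ω ^ 2 ∂μ := integral_nonneg fun ω => sq_nonneg _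
  have h1 : (((eLpNorm m 2 μ).toNNReal : NNReal) : ℝ) = √(∫ ω, m ω ^ 2 ∂μ) := by
    rw [hm.eLpNorm_eq_integral_rpow_norm two_ne_zero ENNReal.ofNat_ne_top]
    simp only [ENNReal.toReal_ofNat, Real.rpow_two, Real.norm_eq_abs, sq_abs]
    rw [← ENNReal.toReal, ENNReal.toReal_ofReal (by positivity), Real.sqrt_eq_rpow]
    norm_num
  rw [NNReal.coe_pow, h1, Real.sq_sqrt h0]

lemma futureSigmaAlgebra_le {T : Ω → Ω} (hT : Measurable T) {f : Ω → ℝ} (hf : Measurable f) :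
    futureSigmaAlgebra T f ≤ mΩ :=
  iSup₂_le fun k _ => (hf.comp (hT.iterate k)).comap_le

lemma measurable_birkhoffPartialSum_future {T : Ω → Ω} {f : Ω → ℝ} (n : ℕ) :
    Measurable[futureSigmaAlgebra T f] (birkhoffPartialSum T f n) := by
  refine Finset.measurable_sum _ fun k hk => ?_
  have h1 : 1 ≤ k := (Finset.mem_Icc.1 hk).1
  exact Measurable.of_comap_le (le_iSup₂_of_le k h1 le_rfl)

end Main

theorem mainTheorem6 {Ω : Type*} {mΩ : MeasurableSpace Ω} (μ : Measure Ω)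
    [IsProbabilityMeasure μ] (T : Ω ≃ᵐ Ω) (hT : Ergodic T μ)
    (𝓕 : Filtration ℤ mΩ) (h𝓕 : ∀ i : ℤ, 𝓕 (i + 1) = MeasurableSpace.comap T (𝓕 i))
    (f m g : Ω → ℝ) (hf : Measurable f)
    (hm : m ∈ martingaleDifferenceSpace μ (𝓕 0) T) (hg : MemLp g 2 μ)
    (hfmg : f =ᵐ[μ] fun ω => m ω + g ω - g (T ω))
    (κ : @Kernel Ω Ω (𝓕 0) (futureSigmaAlgebra T f))
    (hκ : IsRegularCondProb μ (𝓕 0) (futureSigmaAlgebra T f) κ) :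
    ∀ᵐ ω ∂μ, DistribFunTendsto (fun n z => condDistribFun T f κ n ω z)
      (fun z => cdf (gaussianReal 0 ((eLpNorm m 2 μ).toNNReal ^ 2)) z) := by
  set s : ℕ → Ω → ℝ := fun n ω => birkhoffPartialSum T f n ω / √(n : ℝ) with hs
  have hsB : ∀ n, Measurable[futureSigmaAlgebra T f] (s n) := fun n =>
    (measurable_birkhoffPartialSum_future n).div_const _
  have hsm : ∀ n, Measurable[mΩ] (s n) := fun n =>
    (hsB n).mono (futureSigmaAlgebra_le hT.measurable hf) le_rfl
  set ν : ℕ → Ω → Measure ℝ := fun n ω =>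
    @Measure.map Ω ℝ (futureSigmaAlgebra T f) _ (s n) (κ ω) with hν
  have hνreal : ∀ n ω (A : Set ℝ), MeasurableSet A → (ν n ω).real A = (κ ω).real (s n ⁻¹' A) :=
    fun n ω A hA => map_measureReal_apply (hsB n) hA
  have hνprob : ∀ n ω, IsProbabilityMeasure (ν n ω) := fun n ω => by
    have := hκ.isProbabilityMeasure ω
    exact Measure.isProbabilityMeasure_map (hsB n).aemeasurable
  have hchar : ∀ᵐ ω ∂μ, ∀ n, ∀ q : ℚ, charFun (ν n ω) (q : ℝ) =
      (μ[fun ω => Complex.exp (Complex.I * ((q : ℝ) * s n ω : ℝ)) | 𝓕 0]) ω := by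
    refine ae_all_iff.2 fun n => ae_all_iff.2 fun q => ?_
    refine ae_charFun_eq_condExp (𝓕.le 0) (hsm n) (hνprob n) (fun A hA => ?_) q
    simp_rw [hνreal n _ A hA]
    exact hκ.ae_eq_condProb _ (hsB n hA)
  have hrate := ae_all_iff.2 fun N : ℕ => ae_condExp_exp_sub_le hT h𝓕 hf hm hg hfmg N
  filter_upwards [hchar, hrate] with ω h1 h2 z hz
  let ν₀ : ProbabilityMeasure ℝ :=
    ⟨gaussianReal 0 ((eLpNorm m 2 μ).toNNReal ^ 2), inferInstance⟩
  let νs : ℕ → ProbabilityMeasure ℝ := fun n => ⟨ν n ω, hνprob n ω⟩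
  have hweak : Tendsto νs atTop (𝓝 ν₀) := by
    refine ProbabilityMeasure.tendsto_of_charFun_rat fun N => ?_
    obtain ⟨ε, hε, hb⟩ := h2 N
    refine ⟨ε, hε, fun n q hq => ?_⟩
    -- The formula also covers variance zero, where the Gaussian is a point mass.
    have hgauss : charFun (ν₀ : Measure ℝ) (q : ℝ) =
        (Real.exp (-((q : ℝ) ^ 2 * (∫ ω, m ω ^ 2 ∂μ) / 2)) : ℂ) := by
      rw [← coe_toNNReal_eLpNorm_two_sq hm.2.1]
      refine (charFun_gaussianReal _).trans ?_
      push_cast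
      congr 1
      ring
    rw [hgauss]
    exact (congrArg (fun w => ‖w - _‖) (h1 n q)).trans_le (hb n q hq)
  refine (ProbabilityMeasure.tendsto_real_Iic hweak hz).congr fun n => ?_
  exact hνreal n ω _ measurableSet_Iic
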